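/- For $\nu\in\mathbb{R}$ and $x>0$ let $$J_\nu(x)=\Bigl(\frac{x}{2}\Bigr)^{\nu}\sum_{k=0}^{\infty}\frac{(-1)^k}{k!\,\Gamma(\nu+k+1)}\Bigl(\frac{x}{2}\Bigr)^{2k}$$ be the Bessel function of the first kind of order $\nu$. Let $\nu\ge \tfrac12$, $\beta>0$ and $-1-\nu\beta<\alpha\le \beta/2$ be real numbers; if $\nu=\tfrac12$, assume further that $\alpha<\beta/2$. Then for every $x>0$ the function $s\mapsto s^{\alpha}\,\operatorname{sign}(J_\nu(s))\,|J_\nu(s)|^{\beta}$ is integrable on $(0,x)$ and $$\int_0^x s^{\alpha}\,\operatorname{sign}\bigl(J_\nu(s)\bigr)\,\bigl|J_\nu(s)\bigr|^{\beta}\,\mathrm{d}s>0 .$$ -/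

import Mathlib

/-- The Bessel function of the first kind of real order `ν`, by its power series
`J_ν(x) = (x/2)^ν ∑_{k ≥ 0} (-1)^k / (k! Γ(ν + k + 1)) (x/2)^(2k)`, meant for `x > 0`. -/
noncomputable def besselJ (ν x : ℝ) : ℝ :=
  (x / 2) ^ ν *
    ∑' k : ℕ, (-1 : ℝ) ^ k / ((k.factorial : ℝ) * Real.Gamma (ν + k + 1)) * (x / 2) ^ (2 * k)

/-- The odd (sign-preserving) power `sign(y) |y|^β`. -/
noncomputable def signedPow (y β : ℝ) : ℝ := Real.sign y * |y| ^ β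

/-! The function `u = 2^ν √s J_ν(s)` solves `u'' = -Q u` with `Q = 1 - (ν² - 1/4)/s²`, which is
nondecreasing because `ν ≥ 1/2`. In terms of `u` the integrand is `ω φ(u)`, where `φ` is the odd
power and the weight `ω`, a positive multiple of `s^(α - β/2)`, is nonincreasing because `α ≤ β/2`.

By Sturm comparison (`arch_reflection`), a negative arch of `u` after a zero `b`, reflected in `b`,
fits under the preceding positive arch. As `ω` is also larger on the left, the positive part
outweighs the negative one (`integral_arch_pair_pos`).

No enumeration of zeros is needed. If the primitive `F` of the integrand failed to be positive, take
the first `y` with `F y ≤ 0`. Then `u < 0` just before `y`; if `b` is the last zero before `y`, the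
integral over `[2b - y, y]` is positive while `F (2b - y) ≥ 0`, a contradiction
(`integral_odd_comp_pos`). -/

open Set Filter Topology

/-! ### Sturm theory for `u'' = -Q u` -/

/-- A continuous function that goes from nonnegative to negative has a last zero. -/
theorem exists_last_zero {u : ℝ → ℝ} {p q : ℝ} (hpq : p ≤ q) (hu : ContinuousOn u (Icc p q))
    (hp : 0 ≤ u p) (hq : u q < 0) :
    ∃ b ∈ Ico p q, u b = 0 ∧ ∀ s ∈ Ioc b q, u s < 0 := by
  have hc : IsCompact (Icc p q ∩ u ⁻¹' Ici 0) :=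
    isCompact_Icc.of_isClosed_subset (hu.preimage_isClosed_of_isClosed isClosed_Icc isClosed_Ici)
      inter_subset_left
  obtain ⟨b, ⟨hb, hb0⟩, hbm⟩ := hc.exists_isGreatest ⟨p, ⟨le_rfl, hpq⟩, hp⟩
  have hb0 : 0 ≤ u b := hb0
  have hbq : b < q := lt_of_le_of_ne hb.2 (by rintro rfl; linarith)
  have hneg : ∀ s ∈ Ioc b q, u s < 0 := by
    intro s hs
    by_contra! h
    exact absurd (hbm ⟨⟨hb.1.trans hs.1.le, hs.2⟩, h⟩) (not_le.2 hs.1)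
  obtain ⟨c, hc, hc0⟩ := intermediate_value_Icc' hbq.le
    (hu.mono (Icc_subset_Icc_left hb.1)) ⟨hq.le, hb0⟩
  have : c = b := by
    by_contra h
    have := hneg c ⟨lt_of_le_of_ne hc.1 (Ne.symm h), hc.2⟩
    linarith
  exact ⟨b, ⟨hb.1, hbq⟩, this ▸ hc0, hneg⟩

/-- A solution of `u'' = -Q u` with a double zero vanishes to the left of it. -/
theorem eq_zero_of_double_zero {u u' Q : ℝ → ℝ}
    (hu : ∀ s, 0 < s → HasDerivAt u (u' s) s)
    (hu' : ∀ s, 0 < s → HasDerivAt u' (-Q s * u s) s)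
    (hQ : MonotoneOn Q (Ioi 0)) {b : ℝ} (h0 : u b = 0) (h1 : u' b = 0)
    {a : ℝ} (ha : 0 < a) (hab : a ≤ b) : u a = 0 := by
  obtain ⟨K, hK⟩ : ∃ K, ∀ s ∈ Icc a b, |Q s| ≤ K := by
    refine ⟨max |Q a| |Q b|, fun s hs => ?_⟩
    have hs0 : 0 < s := ha.trans_le hs.1
    exact abs_le_max_abs_abs (hQ ha hs0 hs.1) (hQ hs0 (hs0.trans_le hs.2) hs.2)
  -- Grönwall's argument: the energy `u² + u'²` has derivative `2 (1 - Q) u u' ≥ -(1 + K)(u² +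
  -- u'²)`, so the exponential weight makes it nondecreasing.
  have hd : ∀ s, 0 < s → HasDerivAt (fun s => Real.exp ((1 + K) * s) * (u s ^ 2 + u' s ^ 2))
      (Real.exp ((1 + K) * s) * ((1 + K) * (u s ^ 2 + u' s ^ 2) + 2 * (1 - Q s) * (u s * u' s))) s := by
    intro s hs
    refine ((((hasDerivAt_id s).const_mul (1 + K)).exp).mul
      (((hu s hs).pow 2).add ((hu' s hs).pow 2))).congr_deriv ?_
    simp
    ring
  have hm : MonotoneOn (fun s => Real.exp ((1 + K) * s) * (u s ^ 2 + u' s ^ 2)) (Icc a b) := by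
    refine monotoneOn_of_deriv_nonneg (convex_Icc a b)
      (fun s hs => (hd s (ha.trans_le hs.1)).continuousAt.continuousWithinAt)
      (fun s hs => ?_) (fun s hs => ?_)
    · rw [interior_Icc] at hs
      exact (hd s (ha.trans hs.1)).differentiableAt.differentiableWithinAt
    · rw [interior_Icc] at hs
      rw [(hd s (ha.trans hs.1)).deriv]
      refine mul_nonneg (Real.exp_pos _).le ?_
      have h := abs_le.1 (hK s ⟨hs.1.le, hs.2.le⟩)
      nlinarith [mul_nonneg (by linarith : (0:ℝ) ≤ K + Q s) (sq_nonneg (u s - u' s)),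
        mul_nonneg (by linarith : (0:ℝ) ≤ K - Q s) (sq_nonneg (u s + u' s)),
        sq_nonneg (u s + u' s)]
  have := hm ⟨le_rfl, hab⟩ ⟨hab, le_rfl⟩ hab
  simp only [h0, h1] at this
  have h2 : u a ^ 2 + u' a ^ 2 ≤ 0 := by
    by_contra! h
    have := mul_pos (Real.exp_pos ((1 + K) * a)) h
    norm_num at *
    linarith
  nlinarith [sq_nonneg (u' a), sq_nonneg (u a)]

/-- Sturm comparison for solutions of `v'' = -q v`, `w'' = -r w` with equal initial data. -/
theorem sturm_comparison {v v' w w' q r : ℝ → ℝ} {M : ℝ}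
    (hv : ∀ t ∈ Ico 0 M, HasDerivAt v (v' t) t) (hv' : ∀ t ∈ Ico 0 M, HasDerivAt v' (-q t * v t) t)
    (hw : ∀ t ∈ Ico 0 M, HasDerivAt w (w' t) t) (hw' : ∀ t ∈ Ico 0 M, HasDerivAt w' (-r t * w t) t)
    (hv0 : v 0 = 0) (hw0 : w 0 = 0) (hvw : w' 0 = v' 0) (hv1 : v' 0 ≠ 0)
    (hvp : ∀ t ∈ Ioo 0 M, 0 < v t) (hwp : ∀ t ∈ Ioo 0 M, 0 < w t)
    (hqr : ∀ t ∈ Ioo 0 M, r t ≤ q t) {t : ℝ} (ht : t ∈ Ioo 0 M) :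
    v t ≤ w t ∧ ((∀ t ∈ Ioo 0 M, r t < q t) → v t < w t) := by
  have hM : 0 < M := ht.1.trans ht.2
  have hsub : Ioo 0 M ⊆ Ico 0 M := Ioo_subset_Ico_self
  -- The Wronskian: `W' = (q - r) v w ≥ 0` and `W 0 = 0`, and `W / v²` is the derivative of `w / v`.
  set W : ℝ → ℝ := fun t => w' t * v t - w t * v' t with hW
  have hWd : ∀ t ∈ Ico 0 M, HasDerivAt W ((q t - r t) * (v t * w t)) t := by
    intro t ht
    refine (((hw' t ht).mul (hv t ht)).sub ((hw t ht).mul (hv' t ht))).congr_deriv ?_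
    ring
  have hW0 : W 0 = 0 := by simp [hW, hv0, hw0]
  have hWc : ContinuousOn W (Ico 0 M) := fun t ht => (hWd t ht).continuousAt.continuousWithinAt
  have hWnn : ∀ t ∈ Ioo 0 M, 0 ≤ W t := by
    have : MonotoneOn W (Ico 0 M) := by
      refine monotoneOn_of_deriv_nonneg (convex_Ico 0 M) hWc ?_ ?_ <;> rw [interior_Ico]
      · exact fun t ht => (hWd t (hsub ht)).differentiableAt.differentiableWithinAt
      · intro t ht
        rw [(hWd t (hsub ht)).deriv]
        exact mul_nonneg (sub_nonneg.2 (hqr t ht)) (mul_pos (hvp t ht) (hwp t ht)).le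
    intro t ht
    rw [← hW0]
    exact this ⟨le_rfl, hM⟩ (hsub ht) ht.1.le
  have hWpos : (∀ t ∈ Ioo 0 M, r t < q t) → ∀ t ∈ Ioo 0 M, 0 < W t := by
    intro hlt
    have : StrictMonoOn W (Ico 0 M) := by
      refine strictMonoOn_of_deriv_pos (convex_Ico 0 M) hWc ?_
      rw [interior_Ico]
      intro t ht
      rw [(hWd t (hsub ht)).deriv]
      exact mul_pos (sub_pos.2 (hlt t ht)) (mul_pos (hvp t ht) (hwp t ht))
    intro t ht
    rw [← hW0]
    exact this ⟨le_rfl, hM⟩ (hsub ht) ht.1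
  have hrd : ∀ t ∈ Ioo 0 M, HasDerivAt (fun t => w t / v t) (W t / v t ^ 2) t := fun t ht =>
    (hw t (hsub ht)).div (hv t (hsub ht)) (hvp t ht).ne'
  have hrc : ContinuousOn (fun t => w t / v t) (Ioo 0 M) := fun t ht =>
    (hrd t ht).continuousAt.continuousWithinAt
  have hrm : MonotoneOn (fun t => w t / v t) (Ioo 0 M) := by
    refine monotoneOn_of_deriv_nonneg (convex_Ioo 0 M) hrc ?_ ?_ <;> rw [interior_Ioo]
    · exact fun t ht => (hrd t ht).differentiableAt.differentiableWithinAt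
    · intro t ht
      rw [(hrd t ht).deriv]
      exact div_nonneg (hWnn t ht) (sq_nonneg _)
  -- Both functions vanish at `0` with the same nonzero slope, so `w / v` starts from `1`.
  have hlim : Tendsto (fun t => w t / v t) (𝓝[>] 0) (𝓝 1) := by
    have h1 := (hasDerivAt_iff_tendsto_slope.1 (hw 0 ⟨le_rfl, hM⟩)).mono_left
      (nhdsWithin_mono 0 (fun t (ht : t ∈ Ioi (0:ℝ)) => (ne_of_gt ht : t ≠ 0)))
    have h2 := (hasDerivAt_iff_tendsto_slope.1 (hv 0 ⟨le_rfl, hM⟩)).mono_left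
      (nhdsWithin_mono 0 (fun t (ht : t ∈ Ioi (0:ℝ)) => (ne_of_gt ht : t ≠ 0)))
    have h3 := h1.div h2 hv1
    rw [hvw, div_self hv1] at h3
    refine h3.congr' ?_
    filter_upwards [self_mem_nhdsWithin] with t ht
    have : t ≠ 0 := ne_of_gt ht
    simp only [slope_def_field, hv0, hw0, sub_zero, Pi.div_apply]
    exact div_div_div_cancel_right₀ this _ _
  have hge : ∀ t ∈ Ioo 0 M, 1 ≤ w t / v t := by
    intro t ht
    refine le_of_tendsto hlim ?_
    filter_upwards [Ioo_mem_nhdsGT ht.1] with s hs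
    exact hrm ⟨hs.1, hs.2.trans ht.2⟩ ht hs.2.le
  refine ⟨(one_le_div (hvp t ht)).1 (hge t ht), fun hlt => (one_lt_div (hvp t ht)).1 ?_⟩
  have hrs : StrictMonoOn (fun t => w t / v t) (Ioo 0 M) := by
    refine strictMonoOn_of_deriv_pos (convex_Ioo 0 M) hrc ?_
    rw [interior_Ioo]
    intro t ht
    rw [(hrd t ht).deriv]
    exact div_pos (hWpos hlt t ht) (pow_pos (hvp t ht) 2)
  have ht2 : t / 2 ∈ Ioo 0 M := ⟨by linarith [ht.1], by linarith [ht.1, ht.2]⟩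
  exact (hge _ ht2).trans_lt (hrs ht2 ht (by linarith [ht.1]))

/-- Comparison of the two arches of a solution of `u'' = -Q u`, with `Q` increasing,
on both sides of a zero `b`: the right one lies inside the reflection of the left one. -/
theorem arch_reflection {u u' Q : ℝ → ℝ}
    (hu : ∀ s, 0 < s → HasDerivAt u (u' s) s)
    (hu' : ∀ s, 0 < s → HasDerivAt u' (-Q s * u s) s)
    (huc : ContinuousOn u (Ici 0)) (hQ : MonotoneOn Q (Ioi 0))
    {a b x : ℝ} (ha : 0 ≤ a) (hab : a < b) (hua : u a = 0) (hub : u b = 0)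
    (hub' : u' b ≠ 0) (hpos : ∀ s ∈ Ioo a b, 0 < u s) (hneg : ∀ s ∈ Ioo b x, u s < 0) :
    x - b ≤ b - a ∧ ∀ t ∈ Ioo 0 (x - b), 0 < u (b - t) ∧ -u (b + t) ≤ u (b - t) ∧
      (StrictMonoOn Q (Ioi 0) → -u (b + t) < u (b - t)) := by
  have hb : 0 < b := ha.trans_lt hab
  -- `M` is kept free: `M = b - a` yields the bound on the length, which then permits `M = x - b`.
  have cmp : ∀ M, M ≤ x - b → M ≤ b - a → ∀ t ∈ Ioo 0 M,
      -u (b + t) ≤ u (b - t) ∧ ((∀ t ∈ Ioo 0 M, Q (b - t) < Q (b + t)) →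
        -u (b + t) < u (b - t)) := by
    intro M h1 h2 t ht
    have hplus : ∀ t : ℝ, HasDerivAt (fun t => b + t) 1 t := fun t => (hasDerivAt_id t).const_add b
    have hminus : ∀ t : ℝ, HasDerivAt (fun t => b - t) (-1) t :=
      fun t => (hasDerivAt_id t).const_sub b
    refine sturm_comparison (v := fun t => -u (b + t)) (v' := fun t => -u' (b + t))
      (w := fun t => u (b - t)) (w' := fun t => -u' (b - t)) (q := fun t => Q (b + t))
      (r := fun t => Q (b - t)) (M := M) ?_ ?_ ?_ ?_ ?_ ?_ ?_ ?_ ?_ ?_ ?_ ht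
    · intro t ht
      exact ((hu (b + t) (by linarith [ht.1])).comp t (hplus t)).neg.congr_deriv (by ring)
    · intro t ht
      exact ((hu' (b + t) (by linarith [ht.1])).comp t (hplus t)).neg.congr_deriv (by ring)
    · intro t ht
      exact ((hu (b - t) (by linarith [ht.2])).comp t (hminus t)).congr_deriv (by ring)
    · intro t ht
      exact ((hu' (b - t) (by linarith [ht.2])).comp t (hminus t)).neg.congr_deriv (by ring)
    · simp [hub]
    · simp [hub]
    · simp
    · simpa using hub'
    · intro t ht
      exact neg_pos.2 (hneg _ ⟨by linarith [ht.1], by linarith [ht.2]⟩)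
    · intro t ht
      exact hpos _ ⟨by linarith [ht.2], by linarith [ht.1]⟩
    · intro t ht
      exact hQ (mem_Ioi.2 (by linarith [ht.2])) (mem_Ioi.2 (by linarith [ht.1])) (by linarith [ht.1])
  have hlen : x - b ≤ b - a := by
    by_contra! h
    set M := b - a with hM
    have hM0 : 0 < M := sub_pos.2 hab
    -- Only continuity at `a` is available, as `a` may be `0`, where the equation is not assumed.
    -- The limit `t → M` gives `-u (b + M) ≤ u a = 0`, against `u (b + M) < 0`.
    have h1 : Tendsto (fun t => u (b - t)) (𝓝[<] M) (𝓝 (u a)) := by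
      have hc := (huc a ha).tendsto
      refine hc.comp (tendsto_nhdsWithin_iff.2 ⟨?_, ?_⟩)
      · have : Tendsto (fun t : ℝ => b - t) (𝓝 M) (𝓝 (b - M)) :=
          (continuous_const.sub continuous_id).tendsto M
        rw [show b - M = a by rw [hM]; ring] at this
        exact this.mono_left nhdsWithin_le_nhds
      · filter_upwards [self_mem_nhdsWithin] with t ht
        have : t < M := ht
        exact mem_Ici.2 (by linarith)
    have h2 : Tendsto (fun t => -u (b + t)) (𝓝[<] M) (𝓝 (-u (b + M))) := by
      have hc : ContinuousAt u (b + M) := (hu _ (by linarith)).continuousAt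
      have : ContinuousAt (fun t => -u (b + t)) M :=
        (ContinuousAt.comp (f := fun t => b + t) (g := u) hc (by fun_prop)).neg
      exact this.tendsto.mono_left nhdsWithin_le_nhds
    have h3 := le_of_tendsto_of_tendsto h2 h1 (by
      filter_upwards [Ioo_mem_nhdsLT hM0] with t ht
      exact (cmp M h.le le_rfl t ht).1)
    have h4 := hneg (b + M) ⟨by linarith, by linarith⟩
    linarith
  refine ⟨hlen, fun t ht => ⟨hpos _ ⟨by linarith [ht.2], by linarith [ht.1]⟩,
    (cmp _ le_rfl hlen t ht).1, fun hs => (cmp _ le_rfl hlen t ht).2 fun t ht => ?_⟩⟩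
  exact hs (mem_Ioi.2 (by linarith [ht.2])) (mem_Ioi.2 (by linarith [ht.1])) (by linarith [ht.1])

/-! ### Positivity of the weighted integral -/

/-- The weighted area of an arch and of its left neighbour have positive sum. -/
theorem integral_arch_pair_pos {u Q ω φ : ℝ → ℝ} (hφ : StrictMono φ)
    (hodd : ∀ y, φ (-y) = -φ y) (hω : ∀ s, 0 < s → 0 < ω s) (hωa : AntitoneOn ω (Ioi 0))
    (hstr : StrictMonoOn Q (Ioi 0) ∨ StrictAntiOn ω (Ioi 0))
    (hint : ∀ x, 0 < x → IntervalIntegrable (fun s => ω s * φ (u s)) MeasureTheory.volume 0 x)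
    {b L : ℝ} (hL : 0 < L) (hLb : L ≤ b)
    (h : ∀ t ∈ Ioo 0 L, 0 < u (b - t) ∧ -u (b + t) ≤ u (b - t) ∧
      (StrictMonoOn Q (Ioi 0) → -u (b + t) < u (b - t))) :
    0 < ∫ s in (b - L)..(b + L), ω s * φ (u s) := by
  set f : ℝ → ℝ := fun s => ω s * φ (u s) with hf
  have hb : 0 < b := hL.trans_le hLb
  have hint' : ∀ x, 0 ≤ x → IntervalIntegrable f MeasureTheory.volume 0 x := by
    intro x hx
    rcases hx.eq_or_lt with rfl | hx
    · exact IntervalIntegrable.refl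
    · exact hint x hx
  have i1 : IntervalIntegrable f MeasureTheory.volume (b - L) b :=
    (hint' (b - L) (by linarith)).symm.trans (hint b hb)
  have i2 : IntervalIntegrable f MeasureTheory.volume b (b + L) :=
    (hint b hb).symm.trans (hint (b + L) (by linarith))
  have j1 : IntervalIntegrable (fun t => f (b - t)) MeasureTheory.volume 0 L := by
    have := (i1.comp_sub_left b).symm
    simpa using this
  have j2 : IntervalIntegrable (fun t => f (b + t)) MeasureTheory.volume 0 L := by
    have := i2.comp_add_left b
    simpa using this
  have e1 : ∫ t in (0:ℝ)..L, f (b - t) = ∫ s in (b - L)..b, f s := by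
    rw [intervalIntegral.integral_comp_sub_left f b, sub_zero]
  have e2 : ∫ t in (0:ℝ)..L, f (b + t) = ∫ s in b..(b + L), f s := by
    rw [intervalIntegral.integral_comp_add_left f b, add_zero]
  rw [← intervalIntegral.integral_add_adjacent_intervals i1 i2, ← e1, ← e2,
    ← intervalIntegral.integral_add j1 j2]
  refine intervalIntegral.intervalIntegral_pos_of_pos_on (j1.add j2) (fun t ht => ?_) hL
  obtain ⟨h0, h1, h2⟩ := h t ht
  have hφ0 : φ 0 = 0 := by
    have := hodd 0
    rw [neg_zero] at this
    linarith
  have hp1 : b - t ∈ Ioi (0:ℝ) := mem_Ioi.2 (by linarith [ht.2])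
  have hp2 : b + t ∈ Ioi (0:ℝ) := mem_Ioi.2 (by linarith [ht.1])
  have hlt : b - t < b + t := by linarith [ht.1]
  have hw0 : 0 < φ (u (b - t)) := hφ0 ▸ hφ h0
  have hle : -φ (u (b + t)) ≤ φ (u (b - t)) := hodd _ ▸ hφ.monotone h1
  have hω2 := hω _ hp2
  have hω12 := hωa hp1 hp2 hlt.le
  simp only [hf]
  -- Strictness comes either from the values of `φ` or from the weights.
  rcases hstr with hs | hs
  · have hlt' : -φ (u (b + t)) < φ (u (b - t)) := hodd _ ▸ hφ (h2 hs)
    nlinarith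
  · have := hs hp1 hp2 hlt
    nlinarith

/-- Positivity of the weighted integral of an odd function of a solution of `u'' = -Q u`. -/
theorem integral_odd_comp_pos {u u' Q ω φ : ℝ → ℝ}
    (hu : ∀ s, 0 < s → HasDerivAt u (u' s) s)
    (hu' : ∀ s, 0 < s → HasDerivAt u' (-Q s * u s) s)
    (huc : ContinuousOn u (Ici 0)) (hu0 : u 0 = 0) (hupos : ∀ᶠ s in 𝓝[>] 0, 0 < u s)
    (hQ : MonotoneOn Q (Ioi 0)) (hφ : StrictMono φ)
    (hodd : ∀ y, φ (-y) = -φ y) (hω : ∀ s, 0 < s → 0 < ω s) (hωa : AntitoneOn ω (Ioi 0))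
    (hstr : StrictMonoOn Q (Ioi 0) ∨ StrictAntiOn ω (Ioi 0))
    (hint : ∀ x, 0 < x → IntervalIntegrable (fun s => ω s * φ (u s)) MeasureTheory.volume 0 x)
    {x : ℝ} (hx : 0 < x) : 0 < ∫ s in (0:ℝ)..x, ω s * φ (u s) := by
  set f : ℝ → ℝ := fun s => ω s * φ (u s) with hf
  have hφ0 : φ 0 = 0 := by
    have := hodd 0
    rw [neg_zero] at this
    linarith
  have hfpos : ∀ s, 0 < s → 0 < u s → 0 < f s := fun s hs h => mul_pos (hω s hs) (hφ0 ▸ hφ h)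
  obtain ⟨e, he, hepos⟩ : ∃ e, 0 < e ∧ ∀ s ∈ Ioo 0 e, 0 < u s := by
    obtain ⟨e, he, h⟩ := mem_nhdsGT_iff_exists_Ioo_subset.1 hupos
    exact ⟨e, he, h⟩
  -- A double zero would force `u` to vanish inside `(0, e)`, where it is positive.
  have hsimple : ∀ s, 0 < s → u s = 0 → u' s ≠ 0 := by
    intro s hs h0 h1
    have hm : 0 < min (e / 2) s := lt_min (by linarith) hs
    have := eq_zero_of_double_zero hu hu' hQ h0 h1 hm (min_le_right _ _)
    have h2 := hepos _ ⟨hm, (min_le_left _ _).trans_lt (by linarith)⟩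
    linarith
  have hleft : ∀ s, 0 < s → u s = 0 → 0 < u' s → ∀ᶠ y in 𝓝[<] s, u y < 0 := by
    intro s hs h0 h1
    have h2 := (hasDerivAt_iff_tendsto_slope.1 (hu s hs)).mono_left
      (nhdsWithin_mono s (fun t (ht : t ∈ Iio s) => (ne_of_lt ht : t ≠ s)))
    filter_upwards [h2.eventually (lt_mem_nhds h1), self_mem_nhdsWithin] with y hy hys
    have hys : y < s := hys
    rw [slope_def_field, h0, sub_zero] at hy
    by_contra! h
    have := div_nonpos_of_nonneg_of_nonpos h (by linarith : y - s ≤ 0)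
    linarith
  have hleft' : ∀ s, 0 < s → u s = 0 → u' s < 0 → ∀ᶠ y in 𝓝[<] s, 0 < u y := by
    intro s hs h0 h1
    have h2 := (hasDerivAt_iff_tendsto_slope.1 (hu s hs)).mono_left
      (nhdsWithin_mono s (fun t (ht : t ∈ Iio s) => (ne_of_lt ht : t ≠ s)))
    filter_upwards [h2.eventually (gt_mem_nhds h1), self_mem_nhdsWithin] with y hy hys
    have hys : y < s := hys
    rw [slope_def_field, h0, sub_zero] at hy
    by_contra! h
    have := div_nonneg_of_nonpos h (by linarith : y - s ≤ 0)
    linarith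
  have hint2 : ∀ y z, 0 ≤ y → 0 ≤ z → IntervalIntegrable f MeasureTheory.volume y z := by
    have hint' : ∀ x, 0 ≤ x → IntervalIntegrable f MeasureTheory.volume 0 x := by
      intro x hx
      rcases hx.eq_or_lt with rfl | hx
      · exact IntervalIntegrable.refl
      · exact hint x hx
    exact fun y z hy hz => (hint' y hy).symm.trans (hint' z hz)
  set F : ℝ → ℝ := fun x => ∫ s in (0:ℝ)..x, f s with hF
  have hsub : ∀ y z, 0 ≤ y → 0 ≤ z → F z = F y + ∫ s in y..z, f s := fun y z hy hz =>
    (intervalIntegral.integral_add_adjacent_intervals (hint2 0 y le_rfl hy) (hint2 y z hy hz)).symm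
  have hincr : ∀ y z, 0 ≤ y → y < z → (∀ s ∈ Ioo y z, 0 < u s) → F y < F z := by
    intro y z hy hyz h
    rw [hsub y z hy (hy.trans hyz.le)]
    have := intervalIntegral.intervalIntegral_pos_of_pos_on (hint2 y z hy (hy.trans hyz.le))
      (fun s hs => hfpos s (hy.trans_lt hs.1) (h s hs)) hyz
    linarith
  have hF0 : F 0 = 0 := by simp [hF]
  have hFe : ∀ y, 0 < y → y ≤ e → 0 < F y := fun y hy hye => by
    rw [← hF0]
    exact hincr 0 y le_rfl hy fun s hs => hepos s ⟨hs.1, hs.2.trans_le hye⟩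
  by_contra! hneg
  have hFx : F x ≤ 0 := hneg
  have hex : e < x := by
    by_contra! h
    linarith [hFe x hx h]
  have hFc : ContinuousOn F (Icc e x) := by
    refine (intervalIntegral.continuousOn_primitive_interval' (hint2 0 x le_rfl hx.le)
      left_mem_uIcc).mono ?_
    rw [uIcc_of_le hx.le]
    exact Icc_subset_Icc_left he.le
  have hK : IsCompact (Icc e x ∩ F ⁻¹' Iic 0) :=
    isCompact_Icc.of_isClosed_subset (hFc.preimage_isClosed_of_isClosed isClosed_Icc isClosed_Iic)
      inter_subset_left
  obtain ⟨y, ⟨hy, hFy⟩, hymin⟩ := hK.exists_isLeast ⟨x, ⟨hex.le, le_rfl⟩, hFx⟩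
  have hFy : F y ≤ 0 := hFy
  have hy0 : 0 < y := he.trans_le hy.1
  have hbefore : ∀ z, 0 ≤ z → z < y → 0 ≤ F z := by
    intro z hz hzy
    rcases hz.eq_or_lt with rfl | hz
    · exact hF0.ge
    rcases le_or_gt z e with h | h
    · exact (hFe z hz h).le
    · by_contra! h'
      exact absurd (hymin ⟨⟨h.le, hzy.le.trans hy.2⟩, h'.le⟩) (not_le.2 hzy)
  -- Otherwise `F` would increase strictly up to `y` from a nonnegative value.
  have hnotpos : ¬ ∀ᶠ s in 𝓝[<] y, 0 < u s := by
    intro h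
    obtain ⟨l, hl, hl'⟩ := mem_nhdsLT_iff_exists_Ioo_subset.1 h
    have hl : l < y := hl
    have h1 := hincr (max l 0) y (le_max_right _ _) (max_lt hl hy0)
      (fun s hs => hl' ⟨(le_max_left _ _).trans_lt hs.1, hs.2⟩)
    have h2 := hbefore (max l 0) (le_max_right _ _) (max_lt hl hy0)
    linarith
  have hevneg : ∀ᶠ s in 𝓝[<] y, u s < 0 := by
    rcases lt_trichotomy (u y) 0 with h | h | h
    · exact ((hu y hy0).continuousAt.eventually (gt_mem_nhds h)).filter_mono nhdsWithin_le_nhds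
    · rcases lt_or_gt_of_ne (hsimple y hy0 h) with h' | h'
      · exact absurd (hleft' y hy0 h h') hnotpos
      · exact hleft y hy0 h h'
    · exact absurd (((hu y hy0).continuousAt.eventually (lt_mem_nhds h)).filter_mono
        nhdsWithin_le_nhds) hnotpos
  obtain ⟨l, hl, hl'⟩ := mem_nhdsLT_iff_exists_Ioo_subset.1 hevneg
  have hl : l < y := hl
  obtain ⟨m, hm1, hm2⟩ := exists_between (max_lt hl hy0)
  have hm0 : 0 < m := (le_max_right _ _).trans_lt hm1
  have hlm : l < m := (le_max_left _ _).trans_lt hm1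
  obtain ⟨b, hb, hub, hbneg⟩ := exists_last_zero hm0.le
    (huc.mono (fun s hs => hs.1)) hu0.ge (hl' ⟨hlm, hm2⟩)
  have hb0 : 0 < b := by
    by_contra! h
    have hk : 0 < min (e / 2) m := lt_min (by linarith) hm0
    have h1 := hepos _ ⟨hk, (min_le_left _ _).trans_lt (by linarith)⟩
    have h2 := hbneg _ ⟨h.trans_lt hk, min_le_right _ _⟩
    linarith
  have hby : b < y := hb.2.trans hm2
  have hbneg' : ∀ s ∈ Ioo b y, u s < 0 := by
    intro s hs
    rcases le_or_gt s m with h | h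
    · exact hbneg s ⟨hs.1, h⟩
    · exact hl' ⟨hlm.trans h, hs.2⟩
  have hub' : u' b < 0 := by
    refine lt_of_le_of_ne ?_ (hsimple b hb0 hub)
    have h2 := (hasDerivAt_iff_tendsto_slope.1 (hu b hb0)).mono_left
      (nhdsWithin_mono b (fun t (ht : t ∈ Ioi b) => (ne_of_gt ht : t ≠ b)))
    refine le_of_tendsto h2 ?_
    filter_upwards [Ioo_mem_nhdsGT hby] with t ht
    rw [slope_def_field, hub, sub_zero]
    exact div_nonpos_of_nonpos_of_nonneg (hbneg' t ht).le (by linarith [ht.1])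
  obtain ⟨k, hk, hk'⟩ := mem_nhdsLT_iff_exists_Ioo_subset.1 (hleft' b hb0 hub hub')
  have hk : k < b := hk
  obtain ⟨n, hn1, hn2⟩ := exists_between (max_lt hk hb0)
  have hn0 : 0 < n := (le_max_right _ _).trans_lt hn1
  have hkn : k < n := (le_max_left _ _).trans_lt hn1
  obtain ⟨a, ha, hua, hapos⟩ := exists_last_zero (u := fun s => -u s) hn0.le
    (huc.mono (fun s hs => hs.1)).neg (by simp [hu0]) (neg_lt_zero.2 (hk' ⟨hkn, hn2⟩))
  have hapos' : ∀ s ∈ Ioo a b, 0 < u s := by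
    intro s hs
    rcases le_or_gt s n with h | h
    · exact neg_lt_zero.1 (hapos s ⟨hs.1, h⟩)
    · exact hk' ⟨hkn.trans h, hs.2⟩
  obtain ⟨hlen, hrefl⟩ := arch_reflection hu hu' huc hQ ha.1 (ha.2.trans hn2)
    (neg_eq_zero.1 hua) hub hub'.ne hapos' hbneg'
  -- The interval is `[2b - y, y]`; `hlen` gives `2b - y ≥ a ≥ 0`.
  have hfin := integral_arch_pair_pos hφ hodd hω hωa hstr hint (sub_pos.2 hby)
    (by linarith [ha.1]) hrefl
  rw [show b + (y - b) = y by ring] at hfin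
  have h1 := hsub (b - (y - b)) y (by linarith [ha.1]) hy0.le
  have h2 := hbefore (b - (y - b)) (by linarith [ha.1]) (by linarith)
  linarith

/-! ### The power series and its recurrence -/

/-- The entire function `∑ (-z)^k / (k! Γ(ν + k + 1))`. -/
noncomputable def besselG (ν z : ℝ) : ℝ :=
  ∑' k : ℕ, (-1 : ℝ) ^ k / ((k.factorial : ℝ) * Real.Gamma (ν + k + 1)) * z ^ k

/-- Each step multiplies by `ν + k + 1 ≥ 1`. Monotonicity of `Γ` cannot be used, since `Γ` decreases
just after `1`. -/
theorem Gamma_le_Gamma_add_nat {ν : ℝ} (hν : 0 ≤ ν) (k : ℕ) :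
    Real.Gamma (ν + 1) ≤ Real.Gamma (ν + k + 1) := by
  induction k with
  | zero => simp
  | succ k ih =>
    have h : (0:ℝ) < ν + k + 1 := by positivity
    have h1 := Real.Gamma_add_one h.ne'
    have h2 := Real.Gamma_pos_of_pos h
    push_cast
    rw [← add_assoc, h1]
    nlinarith [(Nat.cast_nonneg k : (0:ℝ) ≤ k)]

theorem abs_besselG_coeff_le {ν : ℝ} (hν : 0 ≤ ν) (k : ℕ) :
    |(-1 : ℝ) ^ k / ((k.factorial : ℝ) * Real.Gamma (ν + k + 1))| ≤
      (Real.Gamma (ν + 1))⁻¹ / k.factorial := by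
  have h0 : 0 < Real.Gamma (ν + 1) := Real.Gamma_pos_of_pos (by linarith)
  have h1 := Gamma_le_Gamma_add_nat hν k
  have hf : (0:ℝ) < k.factorial := by positivity
  have h2 := h0.trans_le h1
  rw [abs_div, abs_pow, abs_neg, abs_one, one_pow, abs_of_pos (by positivity), inv_eq_one_div,
    div_div]
  refine one_div_le_one_div_of_le (by positivity) ?_
  rw [mul_comm]
  gcongr

theorem summable_besselG {ν : ℝ} (hν : 0 ≤ ν) (z : ℝ) :
    Summable fun k : ℕ => (-1 : ℝ) ^ k / ((k.factorial : ℝ) * Real.Gamma (ν + k + 1)) * z ^ k := by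
  refine Summable.of_norm_bounded ((Real.summable_pow_div_factorial |z|).mul_left
    (Real.Gamma (ν + 1))⁻¹) fun k => ?_
  rw [norm_mul, norm_pow, Real.norm_eq_abs, Real.norm_eq_abs]
  calc _ ≤ (Real.Gamma (ν + 1))⁻¹ / k.factorial * |z| ^ k := by
        gcongr; exact abs_besselG_coeff_le hν k
    _ = _ := by ring

theorem hasDerivAt_besselG {ν : ℝ} (hν : 0 ≤ ν) (z : ℝ) :
    HasDerivAt (besselG ν) (-besselG (ν + 1) z) z := by
  set a : ℕ → ℝ := fun k => (-1 : ℝ) ^ k / ((k.factorial : ℝ) * Real.Gamma (ν + k + 1)) with ha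
  set R : ℝ := |z| + 1 with hR
  have hz : z ∈ Metric.ball (0:ℝ) R := by simp [hR]
  have hbound : Summable fun k : ℕ => (Real.Gamma (ν + 1))⁻¹ / k.factorial * (k * R ^ (k - 1)) := by
    rw [← summable_nat_add_iff 1]
    refine ((Real.summable_pow_div_factorial R).mul_left (Real.Gamma (ν + 1))⁻¹).congr fun k => ?_
    rw [Nat.factorial_succ]
    push_cast
    have : (k.factorial : ℝ) ≠ 0 := by positivity
    field_simp
  have key := hasDerivAt_tsum_of_isPreconnected (g := fun k z => a k * z ^ k)
    (g' := fun k z => a k * (k * z ^ (k - 1))) (t := Metric.ball 0 R) (y₀ := z) (y := z)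
    hbound Metric.isOpen_ball (convex_ball 0 R).isPreconnected
    (fun k y _ => (hasDerivAt_pow k y).const_mul _)
    (fun k y hy => by
      rw [norm_mul, norm_mul, norm_pow, Real.norm_eq_abs, Real.norm_eq_abs, Real.norm_eq_abs,
        Nat.abs_cast]
      have h1 := abs_besselG_coeff_le hν k
      have h2 : |y| ≤ R := by simpa using (Metric.mem_ball.1 hy).le
      have h0 : 0 < Real.Gamma (ν + 1) := Real.Gamma_pos_of_pos (by linarith)
      gcongr) hz (summable_besselG hν z) hz
  refine key.congr_deriv ?_
  have hs : Summable fun k : ℕ => a k * (k * z ^ (k - 1)) := by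
    rw [← summable_nat_add_iff 1]
    refine (summable_besselG (by linarith : 0 ≤ ν + 1) z).neg.congr fun k => ?_
    simp only [ha, Nat.factorial_succ, Nat.add_sub_cancel, pow_succ]
    push_cast
    have : (k.factorial : ℝ) ≠ 0 := by positivity
    rw [show ν + 1 + k + 1 = ν + (k + 1) + 1 by ring]
    field_simp
  rw [hs.tsum_eq_zero_add]
  simp only [besselG, ← tsum_neg]
  simp only [Nat.cast_zero, zero_mul, mul_zero, zero_add]
  refine tsum_congr fun k => ?_
  simp only [ha, Nat.factorial_succ, Nat.add_sub_cancel, pow_succ]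
  push_cast
  have : (k.factorial : ℝ) ≠ 0 := by positivity
  rw [show ν + 1 + k + 1 = ν + (k + 1) + 1 by ring]
  field_simp

/-- Since `G' = -besselG (ν + 1)` and `G'' = besselG (ν + 2)` for `G = besselG ν`, this is the
differential equation `z G'' + (ν + 1) G' + G = 0`. -/
theorem besselG_recurrence {ν : ℝ} (hν : 0 ≤ ν) (z : ℝ) :
    besselG ν z = (ν + 1) * besselG (ν + 1) z - z * besselG (ν + 2) z := by
  have h1 := summable_besselG (by linarith : 0 ≤ ν + 1) z
  have h2 := summable_besselG (by linarith : 0 ≤ ν + 2) z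
  have h0 := summable_besselG hν z
  have h3 := (h0.sub (h1.mul_left (ν + 1)))
  have e : ∑' k : ℕ, ((-1 : ℝ) ^ k / ((k.factorial : ℝ) * Real.Gamma (ν + k + 1)) * z ^ k -
      (ν + 1) * ((-1 : ℝ) ^ k / ((k.factorial : ℝ) * Real.Gamma (ν + 1 + k + 1)) * z ^ k)) =
      -(z * besselG (ν + 2) z) := by
    -- The constant terms cancel by `Γ(ν + 2) = (ν + 1) Γ(ν + 1)`, leaving a factor `z`.
    rw [h3.tsum_eq_zero_add]
    have e0 : (ν + 1) * (1 / Real.Gamma (ν + 1 + 1)) = 1 / Real.Gamma (ν + 1) := by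
      have h4 : ν + 1 ≠ 0 := by linarith
      rw [Real.Gamma_add_one h4]
      field_simp
    simp only [besselG, ← tsum_mul_left, ← tsum_neg]
    simp only [pow_zero, Nat.factorial_zero, Nat.cast_zero, add_zero, Nat.cast_one, one_mul,
      mul_one, e0, sub_self, zero_add]
    refine tsum_congr fun k => ?_
    have hp : (0:ℝ) < ν + k + 2 := by positivity
    have hG := Real.Gamma_pos_of_pos hp
    have hG1 := Real.Gamma_add_one hp.ne'
    rw [Nat.factorial_succ]
    push_cast
    rw [show ν + (k + 1) + 1 = ν + k + 2 by ring, show ν + 1 + (k + 1) + 1 = ν + k + 2 + 1 by ring,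
      show ν + 2 + k + 1 = ν + k + 2 + 1 by ring, hG1]
    have : (k.factorial : ℝ) ≠ 0 := by positivity
    have hk : (k + 1 : ℝ) ≠ 0 := by positivity
    field_simp
    ring
  rw [h0.tsum_sub (h1.mul_left (ν + 1)), tsum_mul_left] at e
  simp only [besselG] at e ⊢
  linarith

theorem besselG_zero_pos {ν : ℝ} (hν : 0 ≤ ν) : 0 < besselG ν 0 := by
  unfold besselG
  rw [tsum_eq_single 0 (fun k hk => by simp [hk])]
  simpa using Real.Gamma_pos_of_pos (by linarith : 0 < ν + 1)

/-! ### The odd power -/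

theorem signedPow_of_nonneg {y β : ℝ} (hβ : 0 < β) (hy : 0 ≤ y) : signedPow y β = y ^ β := by
  rcases hy.eq_or_lt with rfl | hy
  · simp [signedPow, Real.zero_rpow hβ.ne']
  · rw [signedPow, Real.sign_of_pos hy, one_mul, abs_of_pos hy]

theorem signedPow_neg (y β : ℝ) : signedPow (-y) β = -signedPow y β := by
  simp [signedPow, Real.sign_neg]

theorem signedPow_strictMono {β : ℝ} (hβ : 0 < β) : StrictMono fun y => signedPow y β := by
  refine strictMono_of_odd_strictMonoOn_nonneg (fun y => signedPow_neg y β) fun y hy z hz h => ?_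
  simp only [signedPow_of_nonneg hβ hy, signedPow_of_nonneg hβ hz]
  exact Real.rpow_lt_rpow hy h hβ

theorem continuous_signedPow {β : ℝ} (hβ : 0 < β) : Continuous fun y => signedPow y β := by
  have : (fun y => signedPow y β) = fun y => (max y 0) ^ β - (max (-y) 0) ^ β := by
    funext y
    rcases le_total 0 y with h | h
    · rw [signedPow_of_nonneg hβ h, max_eq_left h, max_eq_right (by linarith),
        Real.zero_rpow hβ.ne', sub_zero]
    · rw [← neg_neg y, signedPow_neg, signedPow_of_nonneg hβ (neg_nonneg.2 h), neg_neg,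
        max_eq_right h, max_eq_left (by linarith), Real.zero_rpow hβ.ne', zero_sub]
  rw [this]
  exact ((continuous_id.max continuous_const).rpow_const fun _ => Or.inr hβ.le).sub
    ((continuous_neg.max continuous_const).rpow_const fun _ => Or.inr hβ.le)

theorem signedPow_mul_of_pos {c : ℝ} (hc : 0 < c) (y β : ℝ) :
    signedPow (c * y) β = c ^ β * signedPow y β := by
  have : Real.sign (c * y) = Real.sign y := by
    rcases lt_trichotomy y 0 with h | rfl | h
    · rw [Real.sign_of_neg h, Real.sign_of_neg (mul_neg_of_pos_of_neg hc h)]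
    · simp
    · rw [Real.sign_of_pos h, Real.sign_of_pos (mul_pos hc h)]
  rw [signedPow, signedPow, this, abs_mul, abs_of_pos hc, Real.mul_rpow hc.le (abs_nonneg y)]
  ring

/-! ### Bessel's equation in normal form -/

theorem besselJ_eq (ν x : ℝ) : besselJ ν x = (x / 2) ^ ν * besselG ν (x ^ 2 / 4) := by
  rw [besselJ, besselG]
  congr 1
  refine tsum_congr fun k => ?_
  rw [pow_mul, div_pow]
  norm_num

theorem continuous_besselG {ν : ℝ} (hν : 0 ≤ ν) : Continuous (besselG ν) :=
  continuous_iff_continuousAt.2 fun z => (hasDerivAt_besselG hν z).continuousAt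

/-- `2 ^ ν √s J_ν(s)`. -/
noncomputable def besselU (ν s : ℝ) : ℝ := s ^ (ν + 1 / 2) * besselG ν (s ^ 2 / 4)

/-- The derivative of `besselU`. -/
noncomputable def besselU' (ν s : ℝ) : ℝ :=
  (ν + 1 / 2) * s ^ (ν - 1 / 2) * besselG ν (s ^ 2 / 4) -
    s ^ (ν + 1 / 2) * (s / 2 * besselG (ν + 1) (s ^ 2 / 4))

theorem hasDerivAt_besselG_sq {ν : ℝ} (hν : 0 ≤ ν) (s : ℝ) :
    HasDerivAt (fun s => besselG ν (s ^ 2 / 4)) (-(s / 2) * besselG (ν + 1) (s ^ 2 / 4)) s := by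
  have h : HasDerivAt (fun s : ℝ => s ^ 2 / 4) (s / 2) s :=
    ((hasDerivAt_pow 2 s).div_const 4).congr_deriv (by norm_num; ring)
  exact ((hasDerivAt_besselG hν _).comp s h).congr_deriv (by ring)

theorem hasDerivAt_besselU {ν : ℝ} (hν : 0 ≤ ν) {s : ℝ} (hs : 0 < s) :
    HasDerivAt (besselU ν) (besselU' ν s) s := by
  refine ((Real.hasDerivAt_rpow_const (p := ν + 1 / 2) (Or.inl hs.ne')).mul
    (hasDerivAt_besselG_sq hν s)).congr_deriv ?_
  rw [besselU', show ν + 1 / 2 - 1 = ν - 1 / 2 by ring]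
  ring

/-- The factor `√s` removes the first-order term of Bessel's equation. -/
theorem hasDerivAt_besselU' {ν : ℝ} (hν : 0 ≤ ν) {s : ℝ} (hs : 0 < s) :
    HasDerivAt (besselU' ν) (-(1 - (ν ^ 2 - 1 / 4) / s ^ 2) * besselU ν s) s := by
  have h1 := ((Real.hasDerivAt_rpow_const (p := ν - 1 / 2) (Or.inl hs.ne')).const_mul
    (ν + 1 / 2)).mul (hasDerivAt_besselG_sq hν s)
  have h2 := (Real.hasDerivAt_rpow_const (p := ν + 1 / 2) (Or.inl hs.ne')).mul
    (((hasDerivAt_id s).div_const 2).mul (hasDerivAt_besselG_sq (by linarith : 0 ≤ ν + 1) s))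
  refine (h1.sub h2).congr_deriv ?_
  have e1 : s ^ (ν + 1 / 2) = s ^ (ν - 1 / 2) * s := by
    rw [← Real.rpow_add_one hs.ne']; ring_nf
  have e2 : s ^ (ν - 1 / 2) = s ^ (ν - 1 / 2 - 1) * s := by
    rw [← Real.rpow_add_one hs.ne']; ring_nf
  rw [besselU, show ν + 1 / 2 - 1 = ν - 1 / 2 by ring, e1, e2, besselG_recurrence hν,
    show ν + 1 + 1 = ν + 2 by ring]
  simp only [id, Pi.mul_apply]
  field_simp
  ring

theorem continuousOn_besselU {ν : ℝ} (hν : 0 ≤ ν) : ContinuousOn (besselU ν) (Ici 0) :=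
  ((continuous_id.rpow_const fun _ => Or.inr (by linarith)).mul
    ((continuous_besselG hν).comp (by fun_prop))).continuousOn

theorem besselU_eventually_pos {ν : ℝ} (hν : 0 ≤ ν) : ∀ᶠ s in 𝓝[>] 0, 0 < besselU ν s := by
  have hc : ContinuousAt (fun s : ℝ => besselG ν (s ^ 2 / 4)) 0 :=
    (hasDerivAt_besselG_sq hν 0).continuousAt
  have h : ∀ᶠ s in 𝓝 (0:ℝ), 0 < besselG ν (s ^ 2 / 4) :=
    hc.eventually (lt_mem_nhds (by simpa using besselG_zero_pos hν))
  filter_upwards [h.filter_mono nhdsWithin_le_nhds, self_mem_nhdsWithin] with s hs hs0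
  exact mul_pos (Real.rpow_pos_of_pos hs0 _) hs

theorem besselJ_eq_besselU {ν s : ℝ} (hs : 0 < s) :
    besselJ ν s = (1 / 2) ^ ν * s ^ (-(1 / 2) : ℝ) * besselU ν s := by
  rw [besselJ_eq, besselU, div_eq_mul_one_div s 2, Real.mul_rpow hs.le (by norm_num),
    show s ^ ν = s ^ (-(1 / 2) : ℝ) * s ^ (ν + 1 / 2) by rw [← Real.rpow_add hs]; ring_nf]
  ring

theorem rpow_mul_signedPow_besselJ {ν s : ℝ} (α β : ℝ) (hs : 0 < s) :
    s ^ α * signedPow (besselJ ν s) β =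
      ((1 / 2) ^ ν) ^ β * s ^ (α - β / 2) * signedPow (besselU ν s) β := by
  rw [besselJ_eq_besselU hs, signedPow_mul_of_pos (by positivity),
    Real.mul_rpow (by positivity) (by positivity), ← Real.rpow_mul hs.le,
    show α - β / 2 = α + -(1 / 2) * β by ring, Real.rpow_add hs]
  ring

/-! ### Integrability and conclusion -/

/-- The integrand is `s^(α + νβ)`, with exponent above `-1`, times a continuous function. -/
theorem intervalIntegrable_rpow_mul_signedPow_besselJ {ν β α : ℝ} (hν : 0 ≤ ν) (hβ : 0 < β)
    (hα : -1 - ν * β < α) {x : ℝ} (hx : 0 < x) :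
    IntervalIntegrable (fun s : ℝ => s ^ α * signedPow (besselJ ν s) β)
      MeasureTheory.volume 0 x := by
  have h : IntervalIntegrable (fun s : ℝ => s ^ (α + ν * β) *
      (((1 / 2) ^ ν) ^ β * signedPow (besselG ν (s ^ 2 / 4)) β)) MeasureTheory.volume 0 x :=
    (intervalIntegral.intervalIntegrable_rpow' (by linarith)).mul_continuousOn
      (continuous_const.mul ((continuous_signedPow hβ).comp
        ((continuous_besselG hν).comp (by fun_prop)))).continuousOn
  refine h.congr fun s hs => ?_
  rw [uIoc_of_le hx.le] at hs
  have hs0 : 0 < s := hs.1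
  rw [besselJ_eq, div_eq_mul_one_div s 2, Real.mul_rpow hs0.le (by norm_num),
    signedPow_mul_of_pos (by positivity), Real.mul_rpow (by positivity) (by positivity),
    ← Real.rpow_mul hs0.le, Real.rpow_add hs0]
  ring

theorem mainTheorem4 (ν β α : ℝ) (hν : 1 / 2 ≤ ν) (hβ : 0 < β)
    (hα : -1 - ν * β < α) (hα' : α ≤ β / 2) (hνα : ν = 1 / 2 → α < β / 2)
    (x : ℝ) (hx : 0 < x) :
    IntervalIntegrable (fun s : ℝ => s ^ α * signedPow (besselJ ν s) β)
        MeasureTheory.volume 0 x ∧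
      0 < ∫ s in (0 : ℝ)..x, s ^ α * signedPow (besselJ ν s) β := by
  have hν0 : 0 ≤ ν := by linarith
  have hI : ∀ x : ℝ, 0 < x → IntervalIntegrable (fun s : ℝ => s ^ α * signedPow (besselJ ν s) β)
      MeasureTheory.volume 0 x :=
    fun x hx => intervalIntegrable_rpow_mul_signedPow_besselJ hν0 hβ hα hx
  refine ⟨hI x hx, ?_⟩
  have hcongr : ∀ x : ℝ, 0 < x → EqOn (fun s : ℝ => s ^ α * signedPow (besselJ ν s) β)
      (fun s => ((1 / 2) ^ ν) ^ β * s ^ (α - β / 2) * signedPow (besselU ν s) β) (uIoc 0 x) := by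
    intro x hx s hs
    rw [uIoc_of_le hx.le] at hs
    exact rpow_mul_signedPow_besselJ α β hs.1
  rw [intervalIntegral.integral_congr_ae (Filter.Eventually.of_forall (hcongr x hx))]
  have hc : (0:ℝ) < ((1 / 2) ^ ν) ^ β := by positivity
  have hν2 : 0 ≤ ν ^ 2 - 1 / 4 := by nlinarith
  refine integral_odd_comp_pos (u := besselU ν) (u' := besselU' ν)
    (Q := fun s => 1 - (ν ^ 2 - 1 / 4) / s ^ 2)
    (ω := fun s => ((1 / 2) ^ ν) ^ β * s ^ (α - β / 2)) (φ := fun y => signedPow y β)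
    (fun s hs => hasDerivAt_besselU hν0 hs) (fun s hs => hasDerivAt_besselU' hν0 hs)
    (continuousOn_besselU hν0) ?_ (besselU_eventually_pos hν0) ?_ (signedPow_strictMono hβ)
    (fun y => signedPow_neg y β) (fun s hs => by positivity) ?_ ?_
    (fun x hx => (hI x hx).congr (hcongr x hx)) hx
  · rw [besselU, Real.zero_rpow (by linarith), zero_mul]
  · intro s hs t _ hst
    have hs : 0 < s := hs
    simp only
    gcongr
  · intro s hs t _ hst
    exact mul_le_mul_of_nonneg_left
      (Real.rpow_le_rpow_of_nonpos hs hst (by linarith)) hc.le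
  -- For `ν = 1/2` the coefficient `Q` is constant, so strictness must come from `α < β/2`; for `ν >
  -- 1/2` it comes from `Q`.
  · rcases hν.eq_or_lt with h | h
    · right
      intro s hs t _ hst
      exact mul_lt_mul_of_pos_left
        (Real.rpow_lt_rpow_of_neg hs hst (by linarith [hνα h.symm])) hc
    · left
      have hν2 : 0 < ν ^ 2 - 1 / 4 := by nlinarith
      intro s hs t _ hst
      have hs : 0 < s := hs
      simp only
      gcongr
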